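/- Let $M$ be a closed (compact, without boundary) connected smooth 4-manifold, and let $g_0$ be a smooth Riemannian metric on $M$ with constant scalar curvature $S_0>0$. Write $dv_g$ and $S_g$ for the volume element and the scalar curvature of a metric $g$, and $0=\lambda_0(g)<\lambda_1(g)\le\lambda_2(g)\le\cdots$ for the eigenvalues of the Laplace–Beltrami operator of $(M,g)$, repeated according to multiplicity; put $dv_0=dv_{g_0}$, $$a_0(g)=\int_M dv_g,\qquad a_1(g)=\frac16\int_M S_g\,dv_g .$$ Let $(u_j)_{j\in\mathbb N}$ be a sequence of positive smooth functions on $M$, let $g_j=u_j^2g_0$, and let $\alpha_0,\alpha_1,\alpha_2,\Lambda$ be real constants such that for all $j$ 1. $a_0(g_j)=\alpha_0$, 2. $a_1(g_j)\le\alpha_1$, 3. $\int_M S_{g_j}^2u_j^4\,dv_0\le\alpha_2$, 4. $0<\Lambda\le\lambda_1(g_j)$. Assume moreover that no subsequence $(v_j)$ of $(u_j)$ satisfies the condition $$(\star)\qquad \text{there are constants } r_0,l_0>0 \text{ such that } \operatorname{Vol}_{g_0}\{x: v_j(x)\ge r_0\}\ge l_0\operatorname{Vol}(M,g_0)\text{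 for all } j .$$ Then there are a subsequence $(u_{j_k})_k$ and a point $x_0\in M$ at which its mass concentrates: with $B(x,r)$ the geodesic balls of $g_0$, $$\Big\{x\in M:\ \lim_{r\to0}\limsup_{k\to\infty}\int_{B(x,r)}u_{j_k}^4\,dv_0\ne0\Big\}=\{x_0\} \quad\text{and}\quad \lim_{k\to\infty}\int_{M\setminus B(x_0,r)}u_{j_k}^4\,dv_0=0\ \text{ for every } r>0 .$$ -/

import Mathlib

open scoped Manifold ContDiff Topology ENNReal
open MeasureTheory Set Filter

noncomputable section

namespace ConfFour

/-- The model space `ℝ⁴`. -/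
abbrev E4 : Type := EuclideanSpace ℝ (Fin 4)

section Metrics

variable {M : Type*} [TopologicalSpace M] [ChartedSpace E4 M] [IsManifold (𝓡 4) ∞ M]

variable (M) in
/-- Smooth Riemannian metrics on the 4-manifold `M`. -/
abbrev Metric4 : Type _ :=
  Bundle.ContMDiffRiemannianMetric (𝓡 4) ∞ E4 (fun x : M => TangentSpace (𝓡 4) x)

/-- The conformal metric `u² g`, for a positive smooth function `u`. -/
def conformal (u : C^∞⟮𝓡 4, M; ℝ⟯) (hu : ∀ x, 0 < u x) (g : Metric4 M) : Metric4 M where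
  inner x := (u x) ^ 2 • g.inner x
  symm x v w := by
    change (u x) ^ 2 * g.inner x v w = (u x) ^ 2 * g.inner x w v
    rw [g.symm]
  pos x v hv := by
    change 0 < (u x) ^ 2 * g.inner x v v
    exact mul_pos (pow_pos (hu x) 2) (g.pos x v hv)
  isVonNBounded x := by
    have h := (g.isVonNBounded x).image
      (((u x)⁻¹ • ContinuousLinearMap.id ℝ (TangentSpace (𝓡 4) x)))
    refine h.subset ?_
    intro v hv
    have hne : u x ≠ 0 := (hu x).ne'
    refine ⟨u x • v, ?_, ?_⟩
    · have hv' : (u x) ^ 2 * g.inner x v v < 1 := hv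
      have : g.inner x (u x • v) (u x • v) = (u x) ^ 2 * g.inner x v v := by
        simp [map_smul, smul_eq_mul]; ring
      change g.inner x (u x • v) (u x • v) < 1
      rw [this]; exact hv'
    · change (u x)⁻¹ • (u x • v) = v
      rw [smul_smul, inv_mul_cancel₀ hne, one_smul]
  contMDiff := by
    have h : ContMDiff (𝓡 4) 𝓘(ℝ, ℝ) ∞ (fun x => (u x) ^ 2) := u.contMDiff.pow 2
    exact h.smul_section g.contMDiff

/-! ### Gradient and distance -/

theorem exists_gradient (g : Metric4 M) (f : M → ℝ) (x : M) :
    ∃ X : TangentSpace (𝓡 4) x, ∀ v : TangentSpace (𝓡 4) x,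
      g.inner x X v = mfderiv (𝓡 4) 𝓘(ℝ, ℝ) f x v := by
  let L : E4 →ₗ[ℝ] Module.Dual ℝ E4 :=
    { toFun := fun v => (g.inner x v : E4 →L[ℝ] ℝ).toLinearMap
      map_add' := fun v w => by
        exact congrArg ContinuousLinearMap.toLinearMap ((g.inner x).map_add v w)
      map_smul' := fun c v => by
        exact congrArg ContinuousLinearMap.toLinearMap ((g.inner x).map_smul c v) }
  have hinj : Function.Injective L := by
    rw [injective_iff_map_eq_zero]
    intro v hv
    by_contra hne
    have h1 : g.inner x v v = 0 := congrArg (fun φ : Module.Dual ℝ E4 => φ v) hv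
    exact (g.pos x v hne).ne' h1
  have hsurj : Function.Surjective L :=
    (LinearMap.injective_iff_surjective_of_finrank_eq_finrank
      (Subspace.dual_finrank_eq).symm).1 hinj
  obtain ⟨X, hX⟩ := hsurj (mfderiv (𝓡 4) 𝓘(ℝ, ℝ) f x : E4 →L[ℝ] ℝ).toLinearMap
  exact ⟨X, fun v => congrArg (fun φ : Module.Dual ℝ E4 => φ v) hX⟩

/-- The gradient `∇f` with respect to `g`: the (unique) vector `X` with `g(X, v) = df(v)`
for all tangent vectors `v`. -/
def gradient (g : Metric4 M) (f : M → ℝ) (x : M) : TangentSpace (𝓡 4) x :=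
  Classical.choose (exists_gradient g f x)

/-- `|∇f|²_g`. -/
def gradNormSq (g : Metric4 M) (f : M → ℝ) (x : M) : ℝ :=
  g.inner x (gradient g f x) (gradient g f x)

open scoped Bundle in
/-- The Riemannian (geodesic) distance of `g`, the infimum of the `g`-lengths of `C¹` paths
(infinite between different components). -/
def geodesicDist (g : Metric4 M) (x y : M) : ℝ≥0∞ :=
  letI : Bundle.RiemannianBundle (fun x : M => TangentSpace (𝓡 4) x) := ⟨g.toRiemannianMetric⟩
  Manifold.riemannianEDist (𝓡 4) x y

/-- The geodesic ball `B(x, r)` of `g`. -/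
def geodesicBall (g : Metric4 M) (x : M) (r : ℝ) : Set M :=
  {y | geodesicDist g x y < ENNReal.ofReal r}

/-! ### Coordinates and curvature -/

/-- The coordinate vector field `∂ᵢ` of the preferred chart at `c`, at the point with
coordinates `y`. -/
def coordVec (c : M) (y : E4) (i : Fin 4) :
    TangentSpace (𝓡 4) ((extChartAt (𝓡 4) c).symm y) :=
  mfderiv 𝓘(ℝ, E4) (𝓡 4) (extChartAt (𝓡 4) c).symm y (EuclideanSpace.single i (1 : ℝ))

/-- The matrix `gᵢⱼ` of `g` in the preferred chart at `c`, as a function of the coordinates. -/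
def metricMatrix (g : Metric4 M) (c : M) (y : E4) : Matrix (Fin 4) (Fin 4) ℝ :=
  Matrix.of fun i j =>
    g.inner ((extChartAt (𝓡 4) c).symm y) (coordVec c y i) (coordVec c y j)

/-- The partial derivative `∂ᵢ f`. -/
def partialDeriv (i : Fin 4) (f : E4 → ℝ) (y : E4) : ℝ :=
  fderiv ℝ f y (EuclideanSpace.single i (1 : ℝ))

/-- The Christoffel symbol `Γᵏᵢⱼ = ½ gᵏˡ (∂ᵢ gⱼₗ + ∂ⱼ gᵢₗ - ∂ₗ gᵢⱼ)` of a metric given in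
coordinates by the matrix field `G`. -/
def christoffel (G : E4 → Matrix (Fin 4) (Fin 4) ℝ) (k i j : Fin 4) (y : E4) : ℝ :=
  (1 / 2 : ℝ) * ∑ l, (G y)⁻¹ k l *
    (partialDeriv i (fun z => G z j l) y + partialDeriv j (fun z => G z i l) y
      - partialDeriv l (fun z => G z i j) y)

/-- The Ricci tensor
`Rᵢⱼ = ∂ₖ Γᵏᵢⱼ - ∂ⱼ Γᵏᵢₖ + Γᵏₖₗ Γˡᵢⱼ - Γᵏⱼₗ Γˡᵢₖ` in coordinates. -/
def ricci (G : E4 → Matrix (Fin 4) (Fin 4) ℝ) (i j : Fin 4) (y : E4) : ℝ :=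
  ∑ k, (partialDeriv k (christoffel G k i j) y - partialDeriv j (christoffel G k i k) y
    + ∑ l, (christoffel G k k l y * christoffel G l i j y
      - christoffel G k j l y * christoffel G l i k y))

/-- The scalar curvature `S_g = gⁱʲ Rᵢⱼ`, computed at each point in the preferred chart at that
point. Sign and normalization: the unit round 4-sphere has scalar curvature `12`. -/
def scalarCurvature (g : Metric4 M) (x : M) : ℝ :=
  ∑ i, ∑ j, (metricMatrix g x (extChartAt (𝓡 4) x x))⁻¹ i j *
    ricci (metricMatrix g x) i j (extChartAt (𝓡 4) x x)

end Metrics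

section Measures

variable {M : Type*} [TopologicalSpace M] [ChartedSpace E4 M] [IsManifold (𝓡 4) ∞ M]
  [T2Space M] [CompactSpace M]

variable (M) in
/-- A smooth partition of unity of `M`, indexed by the preferred charts and subordinate to their
domains. It depends on `M` only. -/
def chartPartition : SmoothPartitionOfUnity M (𝓡 4) M univ :=
  Classical.choose (SmoothPartitionOfUnity.exists_isSubordinate_chartAt_source (𝓡 4) M)

variable [MeasurableSpace M]

/-- The Riemannian volume measure `dv_g`: with `(ρ_c)` a partition of unity subordinate to charts,
the sum over `c` of the images under the inverse charts of the measures
`ρ_c √(det gᵢⱼ) dy` on the chart targets. -/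
def vol (g : Metric4 M) : Measure M :=
  Measure.sum fun c : M =>
    ((volume.restrict (extChartAt (𝓡 4) c).target).withDensity
      (fun y : E4 => ENNReal.ofReal
        (chartPartition M c ((extChartAt (𝓡 4) c).symm y)
          * Real.sqrt (metricMatrix g c y).det))).map (extChartAt (𝓡 4) c).symm

/-- The heat invariant `a₀(g) = ∫ dv_g`, the volume. -/
def heatA0 (g : Metric4 M) : ℝ := ∫ _x, (1 : ℝ) ∂(vol g)

/-- The heat invariant `a₁(g) = (1/6) ∫ S_g dv_g`. -/
def heatA1 (g : Metric4 M) : ℝ := (1 / 6 : ℝ) * ∫ x, scalarCurvature g x ∂(vol g)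

/-- The Rayleigh quotient `∫ |∇f|²_g dv_g / ∫ f² dv_g` of a smooth function. -/
def rayleigh (g : Metric4 M) (f : C^∞⟮𝓡 4, M; ℝ⟯) : ℝ :=
  (∫ x, gradNormSq g f x ∂(vol g)) / ∫ x, (f x) ^ 2 ∂(vol g)

/-- The `k`-th eigenvalue `λ_k(g)` (`λ₀ ≤ λ₁ ≤ λ₂ ≤ …`, repeated according to multiplicity) of the
Laplace–Beltrami operator of the closed Riemannian manifold `(M, g)`, as the Courant–Fischer
min-max value over the `(k+1)`-dimensional spaces of smooth functions. -/
def eigenvalue (g : Metric4 M) (k : ℕ) : ℝ≥0∞ :=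
  ⨅ (V : Submodule ℝ C^∞⟮𝓡 4, M; ℝ⟯) (_ : Module.finrank ℝ V = k + 1),
    ⨆ (f : C^∞⟮𝓡 4, M; ℝ⟯) (_ : f ∈ V) (_ : f ≠ 0), ENNReal.ofReal (rayleigh g f)

/-- The non-blowup condition for the sequence `u` on `(M, g₀)`: there are `r₀, l₀ > 0` with
`Vol {u_j ≥ r₀} ≥ l₀ Vol(M, g₀)` for all `j`. -/
def NonBlowup (g₀ : Metric4 M) (u : ℕ → M → ℝ) : Prop :=
  ∃ r₀ > (0 : ℝ), ∃ l₀ > (0 : ℝ), ∀ j,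
    ENNReal.ofReal l₀ * vol g₀ univ ≤ vol g₀ {x | r₀ ≤ u j x}

/-- The mass `∫_A u⁴ dv₀` of a function on a set. -/
def mass (g₀ : Metric4 M) (u : M → ℝ) (A : Set M) : ℝ≥0∞ :=
  ∫⁻ x in A, ENNReal.ofReal ((u x) ^ 4) ∂(vol g₀)

/-- The set of points at which the mass of the sequence `u` accumulates:
`lim_{r → 0} limsup_j ∫_{B(x,r)} u_j⁴ dv₀ ≠ 0`. -/
def accumulationSet (g₀ : Metric4 M) (u : ℕ → M → ℝ) : Set M :=
  {x | ∃ m : ℝ≥0∞, m ≠ 0 ∧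
    Tendsto (fun r : ℝ => limsup (fun j => mass g₀ (u j) (geodesicBall g₀ x r)) atTop)
      (𝓝[>] 0) (𝓝 m)}

/-- The mass of the sequence `u` concentrates at `x₀`: it accumulates at `x₀` and at no other
point, and all of it escapes into every ball around `x₀`. -/
def MassConcentratesAt (g₀ : Metric4 M) (u : ℕ → M → ℝ) (x₀ : M) : Prop :=
  accumulationSet g₀ u = {x₀} ∧
    ∀ r > (0 : ℝ), Tendsto (fun j => mass g₀ (u j) (geodesicBall g₀ x₀ r)ᶜ) atTop (𝓝 0)

end Measures

end ConfFour

end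

/-! The absence of any non-blowup subsequence means that `u_j → 0` in `g₀`-measure. Since the `L⁴`
norm is fixed by the volume, this improves to `u_j → 0` in `L²`
(`tendsto_integral_sq_of_tendsto_measure`).

In dimension four `|∇f|²` scales by `u⁻²` and the volume by `u⁴`, so the Dirichlet energy of a fixed
smooth `f` for `g_j` is `∫ u_j² |∇f|² dv₀`, with gradient and norm taken for `g₀`. It tends to zero.
Take for `f` a cut-off equal to 1 on a closed set `A` and to 0 on a disjoint closed set `B`. The
Poincaré inequality with constant `Λ` then forces the smaller of the `g_j`-volumes of `A` and `B` to
vanish in the limit (`tendsto_min_measureReal_conformal`).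

Measures of fixed positive mass on a compact space that cannot charge two disjoint closed sets must,
along a subsequence, gather at one point (`exists_subseq_tendsto_compl_nhds`). -/

namespace ConfFour

/-! ### Gradients under conformal and affine changes. -/

section Pointwise

variable {M : Type*} [TopologicalSpace M] [ChartedSpace E4 M] [IsManifold (𝓡 4) ∞ M]

/-- The differential of a real function, as a linear form on the tangent space. -/
noncomputable def differential (f : M → ℝ) (x : M) : TangentSpace (𝓡 4) x →L[ℝ] ℝ :=
  mfderiv (𝓡 4) 𝓘(ℝ, ℝ) f x

theorem inner_gradient (g : Metric4 M) (f : M → ℝ) (x : M) (v : TangentSpace (𝓡 4) x) :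
    g.inner x (gradient g f x) v = differential f x v :=
  Classical.choose_spec (exists_gradient g f x) v

theorem inner_self_nonneg (g : Metric4 M) (x : M) (v : TangentSpace (𝓡 4) x) :
    0 ≤ g.inner x v v := by
  by_cases h : v = 0
  · subst h; simp
  · exact (g.pos x v h).le

theorem eq_gradient (g : Metric4 M) (f : M → ℝ) (x : M) (X : TangentSpace (𝓡 4) x)
    (h : ∀ v : TangentSpace (𝓡 4) x, g.inner x X v = differential f x v) :
    X = gradient g f x := by
  by_contra hne
  refine (g.pos x (X - gradient g f x) (sub_ne_zero.2 hne)).ne' ?_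
  have h1 := congrArg (fun L : TangentSpace (𝓡 4) x →L[ℝ] ℝ => L (X - gradient g f x))
    ((g.inner x).map_sub X (gradient g f x))
  refine h1.trans ?_
  change g.inner x X (X - gradient g f x) - g.inner x (gradient g f x) (X - gradient g f x) = 0
  rw [h, inner_gradient, sub_self]

theorem inner_smul_left (g : Metric4 M) (x : M) (b : ℝ) (v w : TangentSpace (𝓡 4) x) :
    g.inner x (b • v) w = b * g.inner x v w :=
  congrArg (fun L : TangentSpace (𝓡 4) x →L[ℝ] ℝ => L w) ((g.inner x).map_smul b v)

theorem gradNormSq_eq_differential (g : Metric4 M) (f : M → ℝ) (x : M) :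
    gradNormSq g f x = differential f x (gradient g f x) :=
  inner_gradient g f x _

theorem gradNormSq_nonneg (g : Metric4 M) (f : M → ℝ) (x : M) : 0 ≤ gradNormSq g f x :=
  inner_self_nonneg g x _

/-- The differential does not depend on the metric, so the gradient is multiplied by `u⁻²`. -/
theorem gradNormSq_conformal (u : C^∞⟮𝓡 4, M; ℝ⟯) (hu : ∀ x, 0 < u x) (g : Metric4 M)
    (f : M → ℝ) (x : M) :
    gradNormSq (conformal u hu g) f x = ((u x) ^ 2)⁻¹ * gradNormSq g f x := by
  have hne : (u x) ^ 2 ≠ 0 := (pow_pos (hu x) 2).ne'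
  have key : ((u x) ^ 2)⁻¹ • gradient g f x = gradient (conformal u hu g) f x := by
    apply eq_gradient
    intro v
    change (u x) ^ 2 * g.inner x (((u x) ^ 2)⁻¹ • gradient g f x) v = _
    rw [inner_smul_left, inner_gradient, mul_inv_cancel_left₀ hne]
  rw [gradNormSq_eq_differential, ← key, map_smul, gradNormSq_eq_differential, smul_eq_mul]

omit [IsManifold (𝓡 4) ∞ M] in
theorem differential_const_add_mul (f : C^∞⟮𝓡 4, M; ℝ⟯) (a b : ℝ) (x : M)
    (v : TangentSpace (𝓡 4) x) :
    differential (fun y => a + b * f y) x v = b * differential f x v := by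
  have hf : HasMFDerivAt (𝓡 4) 𝓘(ℝ, ℝ) f x (mfderiv (𝓡 4) 𝓘(ℝ, ℝ) f x) :=
    (f.contMDiff.mdifferentiableAt (by simp)).hasMFDerivAt
  have h1 : HasDerivAt (fun t : ℝ => a + b * t) b (f x) := by
    simpa using ((hasDerivAt_id (f x)).const_mul b).const_add a
  have h2 := (h1.hasFDerivAt.hasMFDerivAt.comp x hf).mfderiv
  have h3 := congrArg (fun L : TangentSpace (𝓡 4) x →L[ℝ] ℝ => L v) h2
  exact h3.trans (mul_comm _ _)

theorem gradNormSq_const_add_mul (g : Metric4 M) (f : C^∞⟮𝓡 4, M; ℝ⟯) (a b : ℝ) (x : M) :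
    gradNormSq g (fun y => a + b * f y) x = b ^ 2 * gradNormSq g f x := by
  have key : b • gradient g f x = gradient g (fun y => a + b * f y) x := by
    apply eq_gradient
    intro v
    rw [inner_smul_left, inner_gradient, differential_const_add_mul]
  rw [gradNormSq_eq_differential, ← key, differential_const_add_mul, map_smul,
    gradNormSq_eq_differential, smul_eq_mul]
  ring

/-- Testing on `v = ∇f` and cancelling one factor `|∇f|²` suffices. Energy bounds thus need no
regularity of the pointwise chosen gradient. -/
theorem gradNormSq_le_of_sq_differential_le (g : Metric4 M) (f : M → ℝ) (x : M) {C : ℝ}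
    (hC : 0 ≤ C)
    (h : ∀ v : TangentSpace (𝓡 4) x, (differential f x v) ^ 2 ≤ C * g.inner x v v) :
    gradNormSq g f x ≤ C := by
  have h1 := h (gradient g f x)
  rw [← inner_gradient] at h1
  change (gradNormSq g f x) ^ 2 ≤ C * gradNormSq g f x at h1
  rcases (gradNormSq_nonneg g f x).eq_or_lt with h0 | h0
  · rw [← h0]; exact hC
  · rw [sq] at h1
    exact le_of_mul_le_mul_right h1 h0

open scoped Bundle in
-- Gives access to the general comparison of the bundle norm and the Riemannian distance with
-- charts.
theorem isContinuousRiemannianBundle (g : Metric4 M) :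
    letI : Bundle.RiemannianBundle (fun x : M => TangentSpace (𝓡 4) x) :=
      ⟨g.toRiemannianMetric⟩
    IsContinuousRiemannianBundle E4 (fun x : M => TangentSpace (𝓡 4) x) :=
  letI : Bundle.RiemannianBundle (fun x : M => TangentSpace (𝓡 4) x) := ⟨g.toRiemannianMetric⟩
  ⟨⟨g.inner, g.contMDiff.continuous, fun _ _ _ => rfl⟩⟩

end Pointwise

/-! ### Gradient bounds, geodesic balls and continuity of the metric coefficients. -/

section Local

variable {M : Type*} [TopologicalSpace M] [ChartedSpace E4 M] [IsManifold (𝓡 4) ∞ M]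

open scoped Bundle

/-- In the chart at `x` the derivative of `f` is locally bounded, and near `x` coordinate norms of
tangent vectors are at most a constant times their `g`-norms. -/
theorem eventually_gradNormSq_le (g : Metric4 M) (f : C^∞⟮𝓡 4, M; ℝ⟯) (x : M) :
    ∃ C : ℝ, ∀ᶠ y in 𝓝 x, gradNormSq g f y ≤ C := by
  let : Bundle.RiemannianBundle (fun x : M => TangentSpace (𝓡 4) x) := ⟨g.toRiemannianMetric⟩
  have := isContinuousRiemannianBundle g
  have : IsManifold (𝓡 4) 1 M := IsManifold.of_le (n := ∞) (by simp)
  obtain ⟨C, hC0, hC⟩ := eventually_norm_trivializationAt_lt E4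
    (fun x : M => TangentSpace (𝓡 4) x) x
  set φ := extChartAt (𝓡 4) x with hφ
  have hF : ContMDiffOn 𝓘(ℝ, E4) 𝓘(ℝ, ℝ) ∞ (f ∘ φ.symm) φ.target :=
    f.contMDiff.comp_contMDiffOn (contMDiffOn_extChartAt_symm x)
  have hopen : IsOpen φ.target := isOpen_extChartAt_target x
  have hcont : ContinuousOn (fderiv ℝ (f ∘ φ.symm)) φ.target :=
    hF.contDiffOn.continuousOn_fderiv_of_isOpen hopen (by simp)
  have hxt : φ x ∈ φ.target := mem_extChartAt_target x
  have hK : ∀ᶠ z in 𝓝 (φ x), ‖fderiv ℝ (f ∘ φ.symm) z‖ < ‖fderiv ℝ (f ∘ φ.symm) (φ x)‖ + 1 :=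
    ((hcont.continuousAt (hopen.mem_nhds hxt)).norm).eventually_lt_const (by linarith)
  set K := ‖fderiv ℝ (f ∘ φ.symm) (φ x)‖ + 1
  have hK0 : 0 ≤ K := by positivity
  refine ⟨(K * C) ^ 2, ?_⟩
  filter_upwards [hC, (continuousAt_extChartAt (I := 𝓡 4) x).eventually hK,
    chart_source_mem_nhds E4 x] with y hy hKy hys
  apply gradNormSq_le_of_sq_differential_le _ _ _ (sq_nonneg _)
  intro v
  have hys' : y ∈ φ.source := by simpa [hφ] using hys
  have hyt : φ y ∈ φ.target := φ.map_source hys'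
  have e1 : (f : M → ℝ) =ᶠ[𝓝 y] (f ∘ φ.symm) ∘ φ := by
    filter_upwards [(isOpen_extChartAt_source (I := 𝓡 4) x).mem_nhds hys'] with z hz
    exact congrArg f (φ.left_inv hz).symm
  have hd1 : MDifferentiableAt 𝓘(ℝ, E4) 𝓘(ℝ, ℝ) (f ∘ φ.symm) (φ y) :=
    (hF.contMDiffAt (hopen.mem_nhds hyt)).mdifferentiableAt (by simp)
  have hd2 : MDifferentiableAt (𝓡 4) 𝓘(ℝ, E4) φ y := mdifferentiableAt_extChartAt hys
  have e2 : differential f y v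
      = fderiv ℝ (f ∘ φ.symm) (φ y) (mfderiv (𝓡 4) 𝓘(ℝ, E4) φ y v) := by
    rw [differential, e1.mfderiv_eq, mfderiv_comp y hd1 hd2, mfderiv_eq_fderiv]
    rfl
  have e3 : mfderiv (𝓡 4) 𝓘(ℝ, E4) φ y v
      = (trivializationAt E4 (fun x : M => TangentSpace (𝓡 4) x) x).continuousLinearMapAt ℝ y v := by
    rw [TangentBundle.continuousLinearMapAt_trivializationAt hys]
    rfl
  have e4 : ‖(trivializationAt E4 (fun x : M => TangentSpace (𝓡 4) x) x).continuousLinearMapAt ℝ y v‖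
      ≤ C * ‖v‖ := ContinuousLinearMap.le_of_opNorm_le _ hy.le v
  have e5 : |differential f y v| ≤ K * (C * ‖v‖) := by
    rw [e2, e3]
    exact (ContinuousLinearMap.le_of_opNorm_le _ hKy.le _).trans
      (mul_le_mul_of_nonneg_left e4 hK0)
  have e6 : ‖v‖ ^ 2 = g.inner y v v := (real_inner_self_eq_norm_sq v).symm
  rw [← e6, ← mul_pow, ← sq_abs, mul_assoc]
  gcongr

theorem exists_gradNormSq_le [CompactSpace M] (g : Metric4 M) (f : C^∞⟮𝓡 4, M; ℝ⟯) :
    ∃ C : ℝ, 0 ≤ C ∧ ∀ x, gradNormSq g f x ≤ C := by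
  choose C hC using eventually_gradNormSq_le g f
  obtain ⟨t, ht⟩ := CompactSpace.elim_nhds_subcover (fun x => {y | gradNormSq g f y ≤ C x}) hC
  refine ⟨∑ x ∈ t, |C x|, Finset.sum_nonneg fun _ _ => abs_nonneg _, fun y => ?_⟩
  have hy : y ∈ ⋃ x ∈ t, {y | gradNormSq g f y ≤ C x} := ht ▸ mem_univ y
  simp only [mem_iUnion] at hy
  obtain ⟨x, hx, hxy⟩ := hy
  exact (le_trans hxy (le_abs_self _)).trans
    (Finset.single_le_sum (f := fun x => |C x|) (fun _ _ => abs_nonneg _) hx)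

theorem geodesicBall_mem_nhds (g : Metric4 M) (x : M) {r : ℝ} (hr : 0 < r) :
    geodesicBall g x r ∈ 𝓝 x := by
  let : Bundle.RiemannianBundle (fun x : M => TangentSpace (𝓡 4) x) := ⟨g.toRiemannianMetric⟩
  have := isContinuousRiemannianBundle g
  have : IsManifold (𝓡 4) 1 M := IsManifold.of_le (n := ∞) (by simp)
  exact eventually_riemannianEDist_lt (𝓡 4) x (ENNReal.ofReal_pos.2 hr)

theorem exists_geodesicBall_subset [RegularSpace M] (g : Metric4 M) {x : M} {s : Set M}
    (hs : s ∈ 𝓝 x) : ∃ r > 0, geodesicBall g x r ⊆ s := by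
  let : Bundle.RiemannianBundle (fun x : M => TangentSpace (𝓡 4) x) := ⟨g.toRiemannianMetric⟩
  have := isContinuousRiemannianBundle g
  have : IsManifold (𝓡 4) 1 M := IsManifold.of_le (n := ∞) (by simp)
  obtain ⟨c, hc, h⟩ := setOfPred_riemannianEDist_lt_subset_nhds (𝓡 4) hs
  refine ⟨c, hc, fun y hy => h ?_⟩
  have hy' : Manifold.riemannianEDist (𝓡 4) x y < ENNReal.ofReal c := hy
  rwa [ENNReal.ofReal_coe_nnreal] at hy'

theorem geodesicBall_mono (g : Metric4 M) (x : M) {r s : ℝ} (h : r ≤ s) :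
    geodesicBall g x r ⊆ geodesicBall g x s :=
  fun _ hy => lt_of_lt_of_le hy (ENNReal.ofReal_le_ofReal h)

/-- The field `∂ᵢ` is the image of a constant section under the tangent map of the inverse chart. -/
theorem continuousOn_coordVec (c : M) (i : Fin 4) :
    ContinuousOn (fun y => (⟨(extChartAt (𝓡 4) c).symm y, coordVec c y i⟩ :
      TangentBundle (𝓡 4) M)) (extChartAt (𝓡 4) c).target := by
  have hopen : IsOpen (extChartAt (𝓡 4) c).target := isOpen_extChartAt_target c
  have h := (contMDiffOn_extChartAt_symm (I := 𝓡 4) (n := ∞) c).continuousOn_tangentMapWithin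
    (by simp) hopen.uniqueMDiffOn
  have h2 : Continuous (fun y : E4 => (⟨y, EuclideanSpace.single i (1 : ℝ)⟩ :
      TangentBundle 𝓘(ℝ, E4) E4)) := by
    have := (tangentBundleModelSpaceHomeomorph 𝓘(ℝ, E4)).symm.continuous.comp
      (Continuous.prodMk_left (Y := E4) (X := E4) (EuclideanSpace.single i (1 : ℝ)))
    exact this
  have h3 := h.comp h2.continuousOn (s := (extChartAt (𝓡 4) c).target) (fun y hy => hy)
  refine h3.congr fun y hy => ?_
  simp only [Function.comp, tangentMapWithin, coordVec]
  rw [mfderivWithin_of_isOpen hopen hy]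

theorem continuousOn_metricMatrix (g : Metric4 M) (c : M) :
    ContinuousOn (metricMatrix g c) (extChartAt (𝓡 4) c).target := by
  let : Bundle.RiemannianBundle (fun x : M => TangentSpace (𝓡 4) x) := ⟨g.toRiemannianMetric⟩
  have := isContinuousRiemannianBundle g
  refine continuousOn_pi.2 fun i => continuousOn_pi.2 fun j => ?_
  exact (continuousOn_coordVec c i).inner_bundle (continuousOn_coordVec c j)

end Local

/-! ### The volume measure, its conformal change, and the Poincaré inequality. -/

theorem map_withDensity_comp {α β : Type*} [MeasurableSpace α] [MeasurableSpace β]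
    {μ : Measure α} {φ : α → β} (hφ : AEMeasurable φ μ) {h : β → ℝ≥0∞} (hh : Measurable h) :
    (μ.withDensity (h ∘ φ)).map φ = (μ.map φ).withDensity h := by
  ext s hs
  have hs' : NullMeasurableSet (φ ⁻¹' s) μ := hφ.nullMeasurableSet_preimage hs
  rw [Measure.map_apply_of_aemeasurable (hφ.mono_ac (withDensity_absolutelyContinuous _ _)) hs,
    withDensity_apply₀ _ hs', withDensity_apply _ hs, ← lintegral_indicator hs,
    lintegral_map' (hh.indicator hs).aemeasurable hφ, ← lintegral_indicator₀ hs']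
  rfl

section Volume

variable {M : Type*} [TopologicalSpace M] [ChartedSpace E4 M] [IsManifold (𝓡 4) ∞ M]
  [T2Space M] [CompactSpace M]

theorem tsupport_chartPartition_subset (c : M) :
    tsupport (chartPartition M c) ⊆ (extChartAt (𝓡 4) c).source := by
  rw [extChartAt_source]
  exact Classical.choose_spec (SmoothPartitionOfUnity.exists_isSubordinate_chartAt_source (𝓡 4) M) c

/-- The density of the contribution of the chart at `c` to the volume measure. -/
noncomputable def chartDensity (g : Metric4 M) (c : M) (y : E4) : ℝ :=
  chartPartition M c ((extChartAt (𝓡 4) c).symm y) * Real.sqrt (metricMatrix g c y).det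

theorem continuousOn_chartDensity (g : Metric4 M) (c : M) :
    ContinuousOn (chartDensity g c) (extChartAt (𝓡 4) c).target := by
  refine ContinuousOn.mul ?_ (Real.continuous_sqrt.comp_continuousOn ?_)
  · exact (chartPartition M c).contMDiff.continuous.comp_continuousOn (continuousOn_extChartAt_symm c)
  · exact (Continuous.matrix_det continuous_id).comp_continuousOn (continuousOn_metricMatrix g c)

/-- For 4×4 matrices, `det (t² G) = t⁸ det G`, whose square root carries `t⁴`. -/
theorem chartDensity_conformal (u : C^∞⟮𝓡 4, M; ℝ⟯) (hu : ∀ x, 0 < u x) (g : Metric4 M)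
    (c : M) (y : E4) :
    chartDensity (conformal u hu g) c y
      = chartDensity g c y * (u ((extChartAt (𝓡 4) c).symm y)) ^ 4 := by
  set t := u ((extChartAt (𝓡 4) c).symm y)
  have ht : 0 ≤ t := (hu _).le
  have h1 : metricMatrix (conformal u hu g) c y = t ^ 2 • metricMatrix g c y := rfl
  have h2 : (t ^ 2) ^ 4 = (t ^ 4) ^ 2 := by ring
  rw [chartDensity, h1, Matrix.det_smul, Fintype.card_fin, h2, Real.sqrt_mul (by positivity),
    Real.sqrt_sq (by positivity), chartDensity]
  ring

/-- The partition function has compact support inside the chart domain, where the continuous density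
is bounded. -/
theorem lintegral_chartDensity_lt_top (g : Metric4 M) (c : M) :
    ∫⁻ y in (extChartAt (𝓡 4) c).target, ENNReal.ofReal (chartDensity g c y) < ⊤ := by
  set φ := extChartAt (𝓡 4) c with hφ
  set K := φ '' tsupport (chartPartition M c) with hK
  have hKc : IsCompact K := (isClosed_tsupport _).isCompact.image_of_continuousOn
    ((continuousOn_extChartAt c).mono (tsupport_chartPartition_subset c))
  have hKt : K ⊆ φ.target := by
    rintro _ ⟨x, hx, rfl⟩
    exact φ.map_source (tsupport_chartPartition_subset c hx)
  obtain ⟨B, hB⟩ := hKc.exists_bound_of_continuousOn ((continuousOn_chartDensity g c).mono hKt)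
  have hle : ∀ y ∈ φ.target, ENNReal.ofReal (chartDensity g c y)
      ≤ K.indicator (fun _ => ENNReal.ofReal B) y := by
    intro y hy
    by_cases hyK : y ∈ K
    · rw [indicator_of_mem hyK]
      exact ENNReal.ofReal_le_ofReal ((le_abs_self _).trans (hB y hyK))
    · have h0 : chartPartition M c (φ.symm y) = 0 := by
        by_contra hne
        exact hyK ⟨φ.symm y, subset_tsupport _ hne, φ.right_inv hy⟩
      have h1 : chartDensity g c y = 0 := by rw [chartDensity, h0, zero_mul]
      rw [h1, ENNReal.ofReal_zero]
      exact zero_le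
  calc ∫⁻ y in φ.target, ENNReal.ofReal (chartDensity g c y)
      ≤ ∫⁻ y in φ.target, K.indicator (fun _ => ENNReal.ofReal B) y :=
        setLIntegral_mono' (isOpen_extChartAt_target c).measurableSet hle
    _ ≤ ∫⁻ y, K.indicator (fun _ => ENNReal.ofReal B) y := setLIntegral_le_lintegral _ _
    _ = ENNReal.ofReal B * volume K := lintegral_indicator_const hKc.measurableSet _
    _ < ⊤ := ENNReal.mul_lt_top ENNReal.ofReal_lt_top hKc.measure_lt_top

variable [MeasurableSpace M] [BorelSpace M]

omit [CompactSpace M] [T2Space M] [IsManifold (𝓡 4) ∞ M] in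
theorem aemeasurable_extChartAt_symm (c : M) :
    AEMeasurable (extChartAt (𝓡 4) c).symm
      (volume.restrict (extChartAt (𝓡 4) c).target) :=
  (continuousOn_extChartAt_symm c).aemeasurable (isOpen_extChartAt_target c).measurableSet

theorem vol_conformal (u : C^∞⟮𝓡 4, M; ℝ⟯) (hu : ∀ x, 0 < u x) (g : Metric4 M) :
    vol (conformal u hu g) = (vol g).withDensity (fun x => ENNReal.ofReal ((u x) ^ 4)) := by
  have hm : Measurable (fun x => ENNReal.ofReal ((u x) ^ 4)) :=
    ((u.contMDiff.continuous.pow 4).measurable).ennreal_ofReal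
  rw [vol, vol, withDensity_sum]
  congr 1
  funext c
  have hφ := aemeasurable_extChartAt_symm c
  have hd : AEMeasurable (fun y => ENNReal.ofReal (chartDensity g c y))
      (volume.restrict (extChartAt (𝓡 4) c).target) :=
    ((continuousOn_chartDensity g c).aemeasurable
      (isOpen_extChartAt_target c).measurableSet).ennreal_ofReal
  rw [← map_withDensity_comp (hφ.mono_ac (withDensity_absolutelyContinuous _ _)) hm]
  congr 1
  have hq := withDensity_mul₀ hd (hm.comp_aemeasurable hφ)
  refine Eq.trans ?_ hq
  congr 1
  funext y
  have h4 : 0 ≤ (u ((extChartAt (𝓡 4) c).symm y)) ^ 4 := (pow_pos (hu _) 4).le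
  change ENNReal.ofReal (chartDensity (conformal u hu g) c y) = ENNReal.ofReal (chartDensity g c y)
    * ENNReal.ofReal ((u ((extChartAt (𝓡 4) c).symm y)) ^ 4)
  rw [chartDensity_conformal, ENNReal.ofReal_mul' h4]

instance isFiniteMeasure_vol (g : Metric4 M) : IsFiniteMeasure (vol g) := by
  refine ⟨?_⟩
  have hfin : {c : M | (Function.support (chartPartition M c)).Nonempty}.Finite :=
    (chartPartition M).locallyFinite.finite_nonempty_of_compact
  rw [vol, Measure.sum_apply _ MeasurableSet.univ, tsum_eq_sum (s := hfin.toFinset)]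
  · refine ENNReal.sum_lt_top.2 fun c _ => ?_
    rw [Measure.map_apply_of_aemeasurable ((aemeasurable_extChartAt_symm c).mono_ac
      (withDensity_absolutelyContinuous _ _)) MeasurableSet.univ, preimage_univ,
      withDensity_apply _ MeasurableSet.univ, Measure.restrict_univ]
    exact lintegral_chartDensity_lt_top g c
  · intro c hc
    have h0 : ∀ x, chartPartition M c x = 0 := by
      intro x
      by_contra hne
      exact hc (hfin.mem_toFinset.2 ⟨x, hne⟩)
    simp [h0]

theorem integrable_vol (g : Metric4 M) {f : M → ℝ} (hf : Continuous f) : Integrable f (vol g) :=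
  hf.integrable_of_hasCompactSupport (HasCompactSupport.of_compactSpace f)

theorem integral_vol_conformal (u : C^∞⟮𝓡 4, M; ℝ⟯) (hu : ∀ x, 0 < u x) (g : Metric4 M)
    (f : M → ℝ) :
    ∫ x, f x ∂(vol (conformal u hu g)) = ∫ x, (u x) ^ 4 * f x ∂(vol g) := by
  have hm : Measurable (fun x => ENNReal.ofReal ((u x) ^ 4)) :=
    ((u.contMDiff.continuous.pow 4).measurable).ennreal_ofReal
  rw [vol_conformal, integral_withDensity_eq_integral_toReal_smul hm (by simp)]
  refine integral_congr_ae (Eventually.of_forall fun x => ?_)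
  change (ENNReal.ofReal ((u x) ^ 4)).toReal • f x = _
  rw [ENNReal.toReal_ofReal (pow_pos (hu x) 4).le, smul_eq_mul]

theorem mass_eq_vol_conformal (u : C^∞⟮𝓡 4, M; ℝ⟯) (hu : ∀ x, 0 < u x) (g : Metric4 M)
    (A : Set M) : mass g u A = vol (conformal u hu g) A := by
  rw [vol_conformal, withDensity_apply', mass]

/-- The Poincaré inequality with the first eigenvalue. -/
theorem mul_integral_sq_le_integral_gradNormSq (g : Metric4 M) {Λ : ℝ}
    (h : ENNReal.ofReal Λ ≤ eigenvalue g 1) (f : C^∞⟮𝓡 4, M; ℝ⟯)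
    (hf : ∫ x, f x ∂(vol g) = 0) :
    Λ * ∫ x, (f x) ^ 2 ∂(vol g) ≤ ∫ x, gradNormSq g f x ∂(vol g) := by
  have hD : 0 ≤ ∫ x, gradNormSq g f x ∂(vol g) := integral_nonneg fun x => gradNormSq_nonneg g f x
  have hV : 0 ≤ ∫ x, (f x) ^ 2 ∂(vol g) := integral_nonneg fun x => sq_nonneg _
  set D := ∫ x, gradNormSq g f x ∂(vol g)
  set V := ∫ x, (f x) ^ 2 ∂(vol g) with hVdef
  rcases hV.eq_or_lt with h0 | hpos
  · rw [← h0, mul_zero]; exact hD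
  have hfc : Continuous f := f.contMDiff.continuous
  have hvol : 0 < (vol g).real univ := by
    refine lt_of_le_of_ne measureReal_nonneg fun h0 => hpos.ne' ?_
    have : vol g = 0 := by
      rw [← Measure.measure_univ_eq_zero]
      exact ((measureReal_eq_zero_iff).1 h0.symm)
    rw [hVdef, this, integral_zero_measure]
  -- The cross term vanishes because `f` has mean zero.
  have hsq : ∀ a b : ℝ, ∫ x, (a + b * f x) ^ 2 ∂(vol g) = a ^ 2 * (vol g).real univ + b ^ 2 * V := by
    intro a b
    have e : ∀ x, (a + b * f x) ^ 2 = (a ^ 2 + (2 * a * b) * f x) + b ^ 2 * (f x) ^ 2 :=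
      fun x => by ring
    simp_rw [e]
    rw [integral_add (integrable_vol g (by fun_prop)) (integrable_vol g (by fun_prop)),
      integral_add (integrable_vol g (by fun_prop)) (integrable_vol g (by fun_prop)),
      integral_const_mul, integral_const_mul, hf, integral_const, smul_eq_mul]
    ring
  have hli : LinearIndependent ℝ ![(1 : C^∞⟮𝓡 4, M; ℝ⟯), f] := by
    rw [LinearIndependent.pair_iff]
    intro a b hab
    have hpt : ∀ x, a + b * f x = 0 := by
      intro x
      have := congrArg (fun F : C^∞⟮𝓡 4, M; ℝ⟯ => F x) hab
      simpa using this
    have h1 := hsq a b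
    simp only [hpt] at h1
    have h2 : (0 : ℝ) = a ^ 2 * (vol g).real univ + b ^ 2 * V := by simpa using h1
    have ha : 0 ≤ a ^ 2 * (vol g).real univ := by positivity
    have hb : 0 ≤ b ^ 2 * V := by positivity
    have ha0 : a ^ 2 * (vol g).real univ = 0 := by linarith
    have hb0 : b ^ 2 * V = 0 := by linarith
    constructor
    · simpa [hvol.ne'] using ha0
    · simpa [hpos.ne'] using hb0
  have hrank : Module.finrank ℝ (Submodule.span ℝ (range ![(1 : C^∞⟮𝓡 4, M; ℝ⟯), f])) = 1 + 1 := by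
    rw [finrank_span_eq_card hli, Fintype.card_fin]
  have hle : eigenvalue g 1 ≤ ENNReal.ofReal (D / V) := by
    unfold eigenvalue
    -- The test space is the span of `1` and `f`: a constant term leaves the energy alone and only
    -- enlarges the denominator, so `f` maximizes the quotient there.
    refine (iInf₂_le (Submodule.span ℝ (range ![(1 : C^∞⟮𝓡 4, M; ℝ⟯), f])) hrank).trans ?_
    refine iSup_le fun F => iSup_le fun hF => iSup_le fun _ => ?_
    apply ENNReal.ofReal_le_ofReal
    rw [Matrix.range_cons_cons_empty, Submodule.mem_span_pair] at hF
    obtain ⟨a, b, hab⟩ := hF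
    have hFx : (F : M → ℝ) = fun x => a + b * f x := by
      funext x
      rw [← hab]
      simp
    rw [rayleigh, hFx, hsq]
    simp_rw [gradNormSq_const_add_mul]
    rw [integral_const_mul]
    change b ^ 2 * D / _ ≤ _
    by_cases hb : b = 0
    · subst hb
      simpa using div_nonneg hD hV
    · have hb2 : 0 < b ^ 2 := by positivity
      rw [← mul_div_mul_left D V hb2.ne']
      gcongr
      have : 0 ≤ a ^ 2 * (vol g).real univ := by positivity
      linarith
  have h3 := (ENNReal.ofReal_le_ofReal_iff (div_nonneg hD hV)).1 (h.trans hle)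
  rwa [le_div_iff₀ hpos] at h3

end Volume

/-! ### Two measure-theoretic limit arguments. -/

/-- If a sequence of measures of fixed positive mass cannot charge two disjoint closed sets
asymptotically, then a subsequence concentrates at a point. -/
theorem exists_subseq_tendsto_compl_nhds {X : Type*} [TopologicalSpace X] [CompactSpace X]
    [T2Space X] [FirstCountableTopology X] [MeasurableSpace X]
    (ν : ℕ → Measure X) [∀ j, IsFiniteMeasure (ν j)] {α : ℝ} (hα : 0 < α)
    (hν : ∀ j, (ν j).real univ = α)
    (hsep : ∀ A B : Set X, IsClosed A → IsClosed B → Disjoint A B →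
      Tendsto (fun j => min ((ν j).real A) ((ν j).real B)) atTop (𝓝 0)) :
    ∃ σ : ℕ → ℕ, StrictMono σ ∧ ∃ x₀ : X, ∀ U ∈ 𝓝 x₀,
      Tendsto (fun k => (ν (σ k)).real Uᶜ) atTop (𝓝 0) := by
  set F : Ultrafilter ℕ := hyperfilter ℕ
  have hF : (F : Filter ℕ) ≤ atTop := Nat.hyperfilter_le_atTop
  -- Otherwise finitely many neighbourhoods of vanishing mass along `F` would cover the space.
  obtain ⟨x₀, hx₀⟩ : ∃ x₀ : X, ∀ U ∈ 𝓝 x₀, ¬ Tendsto (fun j => (ν j).real U) F (𝓝 0) := by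
    by_contra! hcon
    choose U hU hUt using hcon
    obtain ⟨t, ht⟩ := CompactSpace.elim_nhds_subcover U hU
    have h0 : Tendsto (fun j => ∑ x ∈ t, (ν j).real (U x)) F (𝓝 0) := by
      simpa using tendsto_finsetSum t fun x _ => hUt x
    have h1 : ∀ j, α ≤ ∑ x ∈ t, (ν j).real (U x) := by
      intro j
      rw [← hν j, ← top_eq_univ, ← ht]
      exact measureReal_biUnion_finset_le t U
    exact absurd (ge_of_tendsto' h0 h1) (not_le.2 hα)
  have hfreq : ∀ U ∈ 𝓝 x₀, ∀ ε > 0, ∃ᶠ j in atTop, (ν j).real Uᶜ < ε := by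
    intro U hU ε hε
    obtain ⟨A, hA, hAc, hAU⟩ := exists_mem_nhds_isClosed_subset (interior_mem_nhds.2 hU)
    have hmin := (hsep A (interior U)ᶜ hAc isOpen_interior.isClosed_compl
      (disjoint_compl_right_iff_subset.2 hAU)).mono_left hF
    -- Along an ultrafilter, not tending to zero already means being eventually bounded below; the
    -- separation hypothesis then empties the complement of `U`.
    obtain ⟨δ, hδ, hAδ⟩ : ∃ δ > 0, ∀ᶠ j in (F : Filter ℕ), δ ≤ (ν j).real A := by
      by_contra! hcon
      refine hx₀ A hA (tendsto_order.2 ⟨fun a ha => Eventually.of_forall fun j =>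
        ha.trans_le measureReal_nonneg, fun δ hδ => ?_⟩)
      exact hcon δ hδ
    have hev : ∀ᶠ j in (F : Filter ℕ), (ν j).real Uᶜ < ε := by
      filter_upwards [hAδ, hmin.eventually_lt_const (lt_min hδ hε)] with j h1 h2
      rcases min_lt_iff.1 h2 with h3 | h3
      · exact absurd (h3.trans_le (min_le_left _ _)) (not_lt.2 h1)
      · exact (measureReal_mono (compl_subset_compl.2 interior_subset)).trans_lt
          (h3.trans_le (min_le_right _ _))
    exact hev.frequently.filter_mono hF
  obtain ⟨W, hW⟩ := (𝓝 x₀).exists_antitone_basis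
  obtain ⟨σ, hσ, hσW⟩ := extraction_forall_of_frequently
    (P := fun n j => (ν j).real (W n)ᶜ < 1 / ((n : ℝ) + 1))
    fun n => hfreq (W n) (hW.mem n) _ (by positivity)
  refine ⟨σ, hσ, x₀, fun U hU => ?_⟩
  obtain ⟨n, hn⟩ := hW.mem_iff.1 hU
  refine squeeze_zero' (Eventually.of_forall fun _ => measureReal_nonneg) ?_
    tendsto_one_div_add_atTop_nhds_zero_nat
  filter_upwards [eventually_ge_atTop n] with k hk
  exact (measureReal_mono (compl_subset_compl.2 ((hW.antitone hk).trans hn))).trans (hσW k).le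

/-- A sequence that is bounded in `L⁴` and converges to zero in measure converges to zero
in `L²`. -/
theorem tendsto_integral_sq_of_tendsto_measure {X : Type*} [MeasurableSpace X] (μ : Measure X)
    [IsFiniteMeasure μ] (u : ℕ → X → ℝ) (hu : ∀ j x, 0 ≤ u j x) (hm : ∀ j, Measurable (u j))
    (h4 : ∀ j, Integrable (fun x => (u j x) ^ 4) μ) {α : ℝ}
    (hα : ∀ j, ∫ x, (u j x) ^ 4 ∂μ ≤ α)
    (hmeas : ∀ r > 0, Tendsto (fun j => μ.real {x | r ≤ u j x}) atTop (𝓝 0)) :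
    Tendsto (fun j => ∫ x, (u j x) ^ 2 ∂μ) atTop (𝓝 0) := by
  have hα0 : 0 ≤ α := (integral_nonneg fun x => by positivity).trans (hα 0)
  -- Where `u < r`, use `u² ≤ r²`; elsewhere use `u² ≤ t u⁴ + t⁻¹`. The parameter `r`, then `t`, is
  -- fixed before `j → ∞`.
  have key : ∀ r > 0, ∀ t > 0, ∀ j, ∫ x, (u j x) ^ 2 ∂μ
      ≤ r ^ 2 * μ.real univ + t * α + t⁻¹ * μ.real {x | r ≤ u j x} := by
    intro r hr t ht j
    have hS : MeasurableSet {x | r ≤ u j x} := measurableSet_le measurable_const (hm j)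
    have hint : Integrable (fun x => r ^ 2 + t * (u j x) ^ 4
        + {x | r ≤ u j x}.indicator (fun _ => t⁻¹) x) μ :=
      ((integrable_const _).add ((h4 j).const_mul t)).add ((integrable_const _).indicator hS)
    have hpt : ∀ x, (u j x) ^ 2 ≤ r ^ 2 + t * (u j x) ^ 4
        + {x | r ≤ u j x}.indicator (fun _ => t⁻¹) x := by
      intro x
      have hu4 : 0 ≤ t * (u j x) ^ 4 := by positivity
      by_cases hx : r ≤ u j x
      · rw [indicator_of_mem (by exact hx)]
        have e : t * (u j x) ^ 4 + t⁻¹ - (u j x) ^ 2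
            = t⁻¹ * ((t * (u j x) ^ 2 - 1 / 2) ^ 2 + 3 / 4) := by
          field_simp; ring
        have : 0 ≤ t * (u j x) ^ 4 + t⁻¹ - (u j x) ^ 2 := by rw [e]; positivity
        nlinarith [sq_nonneg r]
      · rw [indicator_of_notMem (by exact hx)]
        have := pow_le_pow_left₀ (hu j x) (not_le.1 hx).le 2
        linarith
    have h1 := integral_mono_of_nonneg (Eventually.of_forall fun x => sq_nonneg (u j x)) hint
      (Eventually.of_forall hpt)
    have h2 : ∫ x, (r ^ 2 + t * (u j x) ^ 4
        + {x | r ≤ u j x}.indicator (fun _ => t⁻¹) x) ∂μ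
        = μ.real univ * r ^ 2 + t * (∫ x, (u j x) ^ 4 ∂μ) + μ.real {x | r ≤ u j x} * t⁻¹ := by
      have hi : Integrable (fun x => r ^ 2 + t * (u j x) ^ 4) μ :=
        (integrable_const _).add ((h4 j).const_mul t)
      rw [integral_add hi
        ((integrable_const _).indicator hS), integral_add (integrable_const _)
        ((h4 j).const_mul t), integral_const, integral_const_mul, integral_indicator_const _ hS,
        smul_eq_mul, smul_eq_mul]
    rw [h2] at h1
    have h3 := mul_le_mul_of_nonneg_left (hα j) ht.le
    linarith
  refine tendsto_order.2 ⟨fun a ha => Eventually.of_forall fun j =>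
    ha.trans_le (integral_nonneg fun x => sq_nonneg _), fun ε hε => ?_⟩
  obtain ⟨r, hr, hrε⟩ : ∃ r > 0, r ^ 2 * μ.real univ < ε / 3 := by
    have hc : Tendsto (fun r : ℝ => r ^ 2 * μ.real univ) (𝓝[>] 0) (𝓝 0) := by
      have : Continuous (fun r : ℝ => r ^ 2 * μ.real univ) := by fun_prop
      simpa using (this.tendsto 0).mono_left nhdsWithin_le_nhds
    obtain ⟨r, h1, h2⟩ := ((hc.eventually_lt_const (show 0 < ε / 3 by positivity)).and
      self_mem_nhdsWithin).exists
    exact ⟨r, h2, h1⟩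
  -- The shift to `α + 1` covers the case `α = 0`.
  have ht : 0 < ε / (3 * (α + 1)) := by positivity
  have htα : ε / (3 * (α + 1)) * α < ε / 3 := by
    rw [div_mul_eq_mul_div, div_lt_div_iff₀ (by positivity) (by positivity)]
    nlinarith
  have hlim := (hmeas r hr).const_mul (ε / (3 * (α + 1)))⁻¹
  rw [mul_zero] at hlim
  filter_upwards [hlim.eventually_lt_const (show 0 < ε / 3 by positivity)] with j hj
  have := key r hr _ ht j
  linarith

/-! ### Energy, separation and concentration for the conformal sequence. -/

section Sequence

variable {M : Type*} [TopologicalSpace M] [ChartedSpace E4 M] [IsManifold (𝓡 4) ∞ M]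
  [T2Space M] [CompactSpace M] [MeasurableSpace M] [BorelSpace M]

/-- If convergence failed, some `ε` would bound the volumes from below along a subsequence, which is
non-blowup with `r₀ = r` and `l₀ = ε / Vol`. -/
theorem tendsto_measureReal_of_not_nonBlowup (g : Metric4 M) (u : ℕ → M → ℝ)
    (h : ∀ σ : ℕ → ℕ, StrictMono σ → ¬ NonBlowup g (fun j => u (σ j))) {r : ℝ} (hr : 0 < r) :
    Tendsto (fun j => (vol g).real {x | r ≤ u j x}) atTop (𝓝 0) := by
  refine tendsto_order.2 ⟨fun a ha => Eventually.of_forall fun j =>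
    ha.trans_le measureReal_nonneg, fun ε hε => ?_⟩
  by_contra hcon
  have hfr : ∃ᶠ j in atTop, ε ≤ (vol g).real {x | r ≤ u j x} := by
    simpa [Filter.Frequently] using hcon
  obtain ⟨σ, hσ, hσε⟩ := extraction_of_frequently_atTop hfr
  have hV : 0 < (vol g).real univ :=
    hε.trans_le ((hσε 0).trans (measureReal_mono (subset_univ _)))
  refine h σ hσ ⟨r, hr, ε / (vol g).real univ, by positivity, fun j => ?_⟩
  rw [← ofReal_measureReal (μ := vol g) (s := univ), ← ENNReal.ofReal_mul (by positivity),
    div_mul_cancel₀ _ hV.ne', ← ofReal_measureReal (μ := vol g) (s := {x | r ≤ u (σ j) x})]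
  exact ENNReal.ofReal_le_ofReal (hσε j)

theorem integral_gradNormSq_conformal_le (u : C^∞⟮𝓡 4, M; ℝ⟯) (hu : ∀ x, 0 < u x)
    (g : Metric4 M) (f : M → ℝ) {C : ℝ} (hC : ∀ x, gradNormSq g f x ≤ C) :
    ∫ x, gradNormSq (conformal u hu g) f x ∂(vol (conformal u hu g))
      ≤ C * ∫ x, (u x) ^ 2 ∂(vol g) := by
  have hc : Continuous u := u.contMDiff.continuous
  rw [integral_vol_conformal, ← integral_const_mul]
  have e : ∀ x, (u x) ^ 4 * gradNormSq (conformal u hu g) f x = (u x) ^ 2 * gradNormSq g f x := by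
    intro x
    have := (hu x).ne'
    rw [gradNormSq_conformal]
    field_simp
  simp_rw [e]
  refine integral_mono_of_nonneg
    (Eventually.of_forall fun x => mul_nonneg (sq_nonneg _) (gradNormSq_nonneg g f x))
    (integrable_vol g (by fun_prop)) (Eventually.of_forall fun x => ?_)
  change (u x) ^ 2 * gradNormSq g f x ≤ C * (u x) ^ 2
  rw [mul_comm C]
  exact mul_le_mul_of_nonneg_left (hC x) (sq_nonneg _)

/-- A cut-off function bounds the volume of two sets that it separates by its Dirichlet
integral. -/
theorem mul_min_measureReal_le_integral_gradNormSq (g : Metric4 M) {Λ : ℝ} (hΛ : 0 < Λ)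
    (h : ENNReal.ofReal Λ ≤ eigenvalue g 1) (f : C^∞⟮𝓡 4, M; ℝ⟯) {A B : Set M}
    (hA : IsClosed A) (hB : IsClosed B) (hAB : Disjoint A B) (fA : EqOn f 1 A) (fB : EqOn f 0 B) :
    Λ / 2 * min ((vol g).real A) ((vol g).real B) ≤ ∫ x, gradNormSq g f x ∂(vol g) := by
  have hfc : Continuous f := f.contMDiff.continuous
  set m : ℝ := (∫ x, f x ∂(vol g)) / (vol g).real univ with hm
  set F : C^∞⟮𝓡 4, M; ℝ⟯ := f - ContMDiffMap.const m with hF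
  have hFx : (F : M → ℝ) = fun x => -m + 1 * f x := by
    funext x
    change f x - m = _
    ring
  have hF0 : ∫ x, F x ∂(vol g) = 0 := by
    rw [hFx, integral_add (integrable_vol g (by fun_prop)) (integrable_vol g (by fun_prop)),
      integral_const, integral_const_mul, smul_eq_mul, hm]
    by_cases h0 : (vol g).real univ = 0
    · have : vol g = 0 := by
        rw [← Measure.measure_univ_eq_zero]
        exact (measureReal_eq_zero_iff).1 h0
      simp [this]
    · field_simp
      ring
  have hP := mul_integral_sq_le_integral_gradNormSq g h F hF0
  have hgrad : ∀ x, gradNormSq g F x = gradNormSq g f x := by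
    intro x
    rw [hFx, gradNormSq_const_add_mul]
    ring
  simp_rw [hgrad] at hP
  refine le_trans ?_ hP
  rw [div_mul_eq_mul_div, mul_div_assoc]
  refine mul_le_mul_of_nonneg_left ?_ hΛ.le
  have hint : Integrable (fun x => A.indicator (fun _ => (1 - m) ^ 2) x
      + B.indicator (fun _ => m ^ 2) x) (vol g) :=
    ((integrable_const _).indicator hA.measurableSet).add
      ((integrable_const _).indicator hB.measurableSet)
  have hle : ∫ x, (A.indicator (fun _ => (1 - m) ^ 2) x + B.indicator (fun _ => m ^ 2) x) ∂(vol g)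
      ≤ ∫ x, (F x) ^ 2 ∂(vol g) := by
    refine integral_mono hint (integrable_vol g (F.contMDiff.continuous.pow 2)) fun x => ?_
    have hFx' : F x = -m + 1 * f x := congrFun hFx x
    change _ ≤ (F x) ^ 2
    rw [hFx']
    by_cases hxA : x ∈ A
    · have hxB : x ∉ B := disjoint_left.1 hAB hxA
      have hf1 : f x = 1 := fA hxA
      rw [indicator_of_mem hxA, indicator_of_notMem hxB, hf1]
      apply le_of_eq
      ring
    · by_cases hxB : x ∈ B
      · have hf1 : f x = 0 := fB hxB
        rw [indicator_of_notMem hxA, indicator_of_mem hxB, hf1]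
        apply le_of_eq
        ring
      · rw [indicator_of_notMem hxA, indicator_of_notMem hxB, add_zero]
        positivity
  rw [integral_add ((integrable_const _).indicator hA.measurableSet)
    ((integrable_const _).indicator hB.measurableSet), integral_indicator_const _ hA.measurableSet,
    integral_indicator_const _ hB.measurableSet, smul_eq_mul, smul_eq_mul] at hle
  refine le_trans ?_ hle
  set a := (vol g).real A
  set b := (vol g).real B
  have hn : 0 ≤ min a b := le_min measureReal_nonneg measureReal_nonneg
  have h1 := mul_le_mul_of_nonneg_right (min_le_left a b) (sq_nonneg (1 - m))
  have h2 := mul_le_mul_of_nonneg_right (min_le_right a b) (sq_nonneg m)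
  -- The factor `1/2` comes from `(1 - m)² + m² = 1/2 + 2 (m - 1/2)²`.
  nlinarith [mul_nonneg hn (sq_nonneg (m - 1 / 2))]

theorem tendsto_min_measureReal_conformal (g : Metric4 M) (u : ℕ → C^∞⟮𝓡 4, M; ℝ⟯)
    (hu : ∀ j x, 0 < u j x) {Λ : ℝ} (hΛ : 0 < Λ)
    (h : ∀ j, ENNReal.ofReal Λ ≤ eigenvalue (conformal (u j) (hu j) g) 1)
    (h2 : Tendsto (fun j => ∫ x, (u j x) ^ 2 ∂(vol g)) atTop (𝓝 0))
    {A B : Set M} (hA : IsClosed A) (hB : IsClosed B) (hAB : Disjoint A B) :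
    Tendsto (fun j => min ((vol (conformal (u j) (hu j) g)).real A)
      ((vol (conformal (u j) (hu j) g)).real B)) atTop (𝓝 0) := by
  obtain ⟨f, fB, fA, -⟩ := exists_contMDiffMap_zero_one_of_isClosed (𝓡 4) (n := (⊤ : ℕ∞)) hB hA hAB.symm
  obtain ⟨C, hC0, hC⟩ := exists_gradNormSq_le g f
  have hlim := h2.const_mul ((Λ / 2)⁻¹ * C)
  rw [mul_zero] at hlim
  refine squeeze_zero (fun j => le_min measureReal_nonneg measureReal_nonneg) (fun j => ?_) hlim
  have h3 := (mul_min_measureReal_le_integral_gradNormSq _ hΛ (h j) f hA hB hAB fA fB).trans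
    (integral_gradNormSq_conformal_le (u j) (hu j) g f hC)
  rw [mul_assoc]
  exact (le_inv_mul_iff₀ (by positivity)).2 h3

theorem massConcentratesAt_of_tendsto_compl_nhds (g : Metric4 M) (u : ℕ → C^∞⟮𝓡 4, M; ℝ⟯)
    (hu : ∀ j x, 0 < u j x) {α : ℝ} (hα : 0 < α)
    (hvol : ∀ j, (vol (conformal (u j) (hu j) g)).real univ = α) {x₀ : M}
    (h : ∀ U ∈ 𝓝 x₀, Tendsto (fun j => (vol (conformal (u j) (hu j) g)).real Uᶜ) atTop (𝓝 0)) :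
    MassConcentratesAt g (fun j => u j) x₀ := by
  have hmass : ∀ U ∈ 𝓝 x₀, Tendsto (fun j => mass g (u j) Uᶜ) atTop (𝓝 0) := by
    intro U hU
    simp_rw [mass_eq_vol_conformal _ (hu _)]
    have := ENNReal.tendsto_ofReal (h U hU)
    simpa [ofReal_measureReal] using this
  have htot : ∀ j, mass g (u j) univ = ENNReal.ofReal α := by
    intro j
    rw [mass_eq_vol_conformal _ (hu j), ← hvol j, ofReal_measureReal]
  refine ⟨?_, fun r hr => hmass _ (geodesicBall_mem_nhds g x₀ hr)⟩
  ext x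
  rw [mem_singleton_iff]
  constructor
  · rintro ⟨m, hm, hlim⟩
    by_contra hne
    -- A point `x ≠ x₀` has a closed neighbourhood missing `x₀`; its mass tends to zero, so the
    -- limsup vanishes for all small radii.
    have hcl : {x₀}ᶜ ∈ 𝓝 x := isOpen_compl_singleton.mem_nhds hne
    obtain ⟨K, hK, hKc, hKx⟩ := exists_mem_nhds_isClosed_subset hcl
    have hKU : Kᶜ ∈ 𝓝 x₀ := hKc.isOpen_compl.mem_nhds fun hx => hKx hx rfl
    obtain ⟨r, hr, hrK⟩ := exists_geodesicBall_subset g hK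
    have hzero := hmass _ hKU
    rw [compl_compl] at hzero
    refine hm (tendsto_nhds_unique hlim (tendsto_const_nhds.congr' ?_))
    filter_upwards [Ioc_mem_nhdsGT hr] with s hs
    refine (Tendsto.limsup_eq ?_).symm
    exact tendsto_of_tendsto_of_tendsto_of_le_of_le tendsto_const_nhds hzero
      (fun _ => zero_le) fun j => lintegral_mono_set ((geodesicBall_mono g x hs.2).trans hrK)
  · rintro rfl
    refine ⟨ENNReal.ofReal α, (ENNReal.ofReal_pos.2 hα).ne', tendsto_const_nhds.congr' ?_⟩
    filter_upwards [self_mem_nhdsWithin] with r hr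
    refine (Tendsto.limsup_eq ?_).symm
    have hcompl := hmass _ (geodesicBall_mem_nhds g x hr)
    -- At the concentration point every ball captures the full mass `α` in the limit.
    have hlow : Tendsto (fun j => ENNReal.ofReal α - mass g (u j) (geodesicBall g x r)ᶜ) atTop
        (𝓝 (ENNReal.ofReal α)) := by
      simpa using ENNReal.Tendsto.sub tendsto_const_nhds hcompl (Or.inl ENNReal.ofReal_ne_top)
    refine tendsto_of_tendsto_of_tendsto_of_le_of_le hlow tendsto_const_nhds (fun j => ?_)
      fun j => ?_
    · change ENNReal.ofReal α - _ ≤ _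
      rw [tsub_le_iff_right, ← htot j, mass_eq_vol_conformal _ (hu j),
        mass_eq_vol_conformal _ (hu j), mass_eq_vol_conformal _ (hu j)]
      exact (measure_univ_le_add_compl _)
    · change mass g (u j) _ ≤ _
      rw [← htot j]
      exact lintegral_mono_set (subset_univ _)

end Sequence

end ConfFour

theorem proposition5p3
    {M : Type*} [TopologicalSpace M] [T2Space M] [CompactSpace M] [ConnectedSpace M]
    [ChartedSpace ConfFour.E4 M] [IsManifold (𝓡 4) ∞ M] [MeasurableSpace M] [BorelSpace M]
    (g₀ : ConfFour.Metric4 M)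
    (S₀ : ℝ) (hS₀ : 0 < S₀) (hconst : ∀ x, ConfFour.scalarCurvature g₀ x = S₀)
    (u : ℕ → C^∞⟮𝓡 4, M; ℝ⟯) (hu : ∀ j x, 0 < u j x)
    (α₀ α₁ α₂ Λ : ℝ)
    (h_a0 : ∀ j, ConfFour.heatA0 (ConfFour.conformal (u j) (hu j) g₀) = α₀)
    (h_a1 : ∀ j, ConfFour.heatA1 (ConfFour.conformal (u j) (hu j) g₀) ≤ α₁)
    (h_S : ∀ j, ∫ x, (ConfFour.scalarCurvature (ConfFour.conformal (u j) (hu j) g₀) x) ^ 2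
      * (u j x) ^ 4 ∂(ConfFour.vol g₀) ≤ α₂)
    (hΛ : 0 < Λ)
    (h_eig : ∀ j, ENNReal.ofReal Λ ≤ ConfFour.eigenvalue (ConfFour.conformal (u j) (hu j) g₀) 1)
    (h_blowup : ∀ σ : ℕ → ℕ, StrictMono σ →
      ¬ ConfFour.NonBlowup g₀ (fun j => u (σ j))) :
    ∃ σ : ℕ → ℕ, StrictMono σ ∧ ∃ x₀ : M,
      ConfFour.MassConcentratesAt g₀ (fun j => u (σ j)) x₀ := by
  open ConfFour in
  have hc : ∀ j, Continuous (u j) := fun j => (u j).contMDiff.continuous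
  have htot : ∀ j, (vol (conformal (u j) (hu j) g₀)).real univ = α₀ := by
    intro j
    have := h_a0 j
    rwa [heatA0, integral_const, smul_eq_mul, mul_one] at this
  have hint : ∀ j, ∫ x, (u j x) ^ 4 ∂(vol g₀) = α₀ := by
    intro j
    rw [← h_a0 j, heatA0, integral_vol_conformal]
    simp
  have hne : vol g₀ ≠ 0 := by
    intro h0
    -- With zero volume, the non-blowup inequality would hold trivially as `0 ≤ 0`.
    exact h_blowup id strictMono_id ⟨1, one_pos, 1, one_pos, fun j => by simp [h0]⟩
  have hα : 0 < α₀ := by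
    rw [← hint 0, integral_pos_iff_support_of_nonneg (fun x => (pow_pos (hu 0 x) 4).le)
      (integrable_vol g₀ ((hc 0).pow 4))]
    have : Function.support (fun x => (u 0 x) ^ 4) = univ :=
      eq_univ_of_forall fun x => (pow_pos (hu 0 x) 4).ne'
    rw [this]
    exact Measure.measure_univ_pos.2 hne
  have h2 : Tendsto (fun j => ∫ x, (u j x) ^ 2 ∂(vol g₀)) atTop (𝓝 0) :=
    tendsto_integral_sq_of_tendsto_measure (vol g₀) (fun j => u j) (fun j x => (hu j x).le)
      (fun j => (hc j).measurable) (fun j => integrable_vol g₀ ((hc j).pow 4))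
      (fun j => (hint j).le)
      fun r hr => tendsto_measureReal_of_not_nonBlowup g₀ (fun j => u j) h_blowup hr
  have : SecondCountableTopology M := ChartedSpace.secondCountable_of_sigmaCompact E4 M
  obtain ⟨σ, hσ, x₀, hx₀⟩ := exists_subseq_tendsto_compl_nhds
    (fun j => vol (conformal (u j) (hu j) g₀)) hα htot fun A B hA hB hAB =>
      tendsto_min_measureReal_conformal g₀ u hu hΛ h_eig h2 hA hB hAB
  exact ⟨σ, hσ, x₀, massConcentratesAt_of_tendsto_compl_nhds g₀ (fun k => u (σ k))
    (fun k => hu (σ k)) hα (fun k => htot (σ k)) hx₀⟩
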